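/- Let $n\ge 2$, $\Gamma=\{1,\dots,n\}$, and let $(\Gamma,E_k)$, $k\in\mathcal I$, be a finite family of connected undirected simple graphs; $N_{ik}$ is the set of neighbours of $i$ in $E_k$. Fix $\xi>0$, let $D=[-\xi,\xi]^{\Gamma\times\Gamma}$, and call a continuous map $d:[0,\infty)\to D$ a disturbance realization. A switching function is a right-continuous, piecewise constant $\sigma:[0,\infty)\to\mathcal I$; its switching times are the $t>0$ with $\sigma(t^-)\ne\sigma(t^+)$. The state $x:[0,\infty)\to\mathbb R^n$ is continuous and, at every $t\geq 0$ that is not a switching time, satisfies, with $k=\sigma(t)$, $$\dot x_i=\sum_{j\in N_{ik}}(\tilde y_{ij}-x_i),\qquad i\in\Gamma,$$ where $y_{ij}=x_j+d_{ij}(t)$ and $(\tilde y_{ij})_{j\in N_{ik}}$ is chosen by the lazy rule: it minimizes $\bigl|\sum_{j\in N_{ik}}(\tilde y_{ij}-x_i)\bigr|$ subject to $\tilde y_{ij}\in[y_{ij}-\xi,y_{ij}+\xi]$ for $j\in N_{ik}$ (multiple minimizers give the same $\dot x_i$). Put $\mathcal V(x)=\max_i x_i-\min_i x_i$. For $d\in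 D$ let $P(d,E_k)$ be the set of the $x\in\mathbb R^n$ with $$-\frac{\sum_{j\in N_{ik}}d_{ij}}{|N_{ik}|}-\xi\le\frac{\sum_{j\in N_{ik}}x_j}{|N_{ik}|}-x_i\le-\frac{\sum_{j\in N_{ik}}d_{ij}}{|N_{ik}|}+\xi\qquad\text{for all } i\in\Gamma,$$ and let $P(D,E_k)=\bigcup_{d\in D}P(d,E_k)$, $P(D,E_k)+\nu=\{x:\exists y\in P(D,E_k),\ \|x-y\|_\infty\le\nu\}$, $L(D,E_k)=\max_{x\in P(D,E_k)}\mathcal V(x)$ and $S(D,E_k,\nu)=\{x\in\mathbb R^n:\mathcal V(x)\le L(D,E_k)+2\nu\}$. Let $\nu>0$ and $0<\gamma<1$. Call $q>0$ admissible for $E_k$ if, for every disturbance realization, every $t\ge0$ and every solution $x$ on $[t,t+q]$ of the above equation with fixed edgeset $E_k$, there is $s\in[t,t+q]$ such that $\mathcal V(x(s))<\gamma\,\mathcal V(x(t))$ or $x(s)\in P(D,E_k)+\nu$. **Theorem.** The maxima $L(D,E_k)$ exist, and for every $k\in\mathcal I$ there is an admissible time. Moreover, let $q_k(\nu,\gamma)$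 be any admissible time for $E_k$, $k\in\mathcal I$, and put $\tau(\nu,\gamma)=\max_{k\in\mathcal I}q_k(\nu,\gamma)$. Let $\sigma$ be any switching function such that any two distinct switching times are at least $\tau(\nu,\gamma)$ apart and every $k\in\mathcal I$ is recurrent (for all $t\ge0$ there is $t_k\ge t$ with $\sigma(t_k)=k$). Then, for every disturbance realization and every resulting state trajectory $x$ (whatever its initial state), there is a finite time $\bar t>0$ such that $$x(t)\in T=\bigcap_{k\in\mathcal I}S(D,E_k,\nu)\qquad\text{for all } t\ge\bar t .$$ -/

import Mathlib

open Filter Topology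

/-- The neighbourhood `N_i` of agent `i` in the network with edgeset `G`. -/
noncomputable def nbrs {n : ℕ} (G : SimpleGraph (Fin n)) (i : Fin n) : Finset (Fin n) :=
  haveI := Classical.decRel G.Adj
  Finset.univ.filter fun j => G.Adj i j

/-- The hypercube `D` of the disturbance vectors with all entries in `[-ξ, ξ]`. -/
def disturbanceBox (n : ℕ) (ξ : ℝ) : Set (Fin n → Fin n → ℝ) :=
  {d | ∀ i j, -ξ ≤ d i j ∧ d i j ≤ ξ}

/-- A disturbance realization: continuous in time, with values in the hypercube `D`. -/
def IsDisturbance {n : ℕ} (ξ : ℝ) (d : ℝ → Fin n → Fin n → ℝ) : Prop :=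
  ContinuousOn d (Set.Ici 0) ∧ ∀ t, 0 ≤ t → d t ∈ disturbanceBox n ξ

/-- The estimates compatible with the measures `y j`, `j ∈ N`. -/
def candidateEstimates {n : ℕ} (N : Finset (Fin n)) (ξ : ℝ) (y : Fin n → ℝ) :
    Set (Fin n → ℝ) :=
  {z | ∀ j ∈ N, z j ∈ Set.Icc (y j - ξ) (y j + ξ)}

/-- The lazy rule for an agent with state `xi`, neighbourhood `N` and measures `y`: the
estimates `z` minimize `|∑ j ∈ N, (z j - xi)|` among all the compatible estimates. -/
def IsLazyEstimate {n : ℕ} (N : Finset (Fin n)) (ξ xi : ℝ) (y z : Fin n → ℝ) : Prop :=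
  z ∈ candidateEstimates N ξ y ∧
    IsMinOn (fun w : Fin n → ℝ => |∑ j ∈ N, (w j - xi)|) (candidateEstimates N ξ y) z

/-- `v` is the control vector produced by the linear protocol with the lazy rule, on the edgeset
`G`, at the state `x` and for the disturbance `d` (so that agent `i` measures `x j + d i j`). -/
def IsLazyControl {n : ℕ} (G : SimpleGraph (Fin n)) (ξ : ℝ) (d : Fin n → Fin n → ℝ)
    (x v : Fin n → ℝ) : Prop :=
  ∀ i, ∃ z : Fin n → ℝ,
    IsLazyEstimate (nbrs G i) ξ (x i) (fun j => x j + d i j) z ∧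
      v i = ∑ j ∈ nbrs G i, (z j - x i)

/-- The switching times of `σ`: the times `t > 0` with `σ(t⁻) ≠ σ(t⁺)`. -/
def switchingTimes {I : Type*} (σ : ℝ → I) : Set ℝ :=
  {t | 0 < t ∧ ∃ k l, k ≠ l ∧ (∀ᶠ s in 𝓝[<] t, σ s = k) ∧ (∀ᶠ s in 𝓝[>] t, σ s = l)}

/-- A switching function on `[0, ∞)`: at each time it is constant on some interval to the right,
which includes that time, and constant on some interval to the left. -/
def IsSwitchingFunction {I : Type*} (σ : ℝ → I) : Prop :=
  (∀ t, 0 ≤ t → ∀ᶠ s in 𝓝[>] t, σ s = σ t) ∧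
    ∀ t, 0 < t → ∃ k, ∀ᶠ s in 𝓝[<] t, σ s = k

/-- Any two switching times are at least `τ` apart. -/
def HasDwellTime {I : Type*} (σ : ℝ → I) (τ : ℝ) : Prop :=
  ∀ s ∈ switchingTimes σ, ∀ t ∈ switchingTimes σ, s < t → τ ≤ t - s

/-- Every index is visited at arbitrarily late times. -/
def IsRecurrent {I : Type*} (σ : ℝ → I) : Prop :=
  ∀ k, ∀ t, 0 ≤ t → ∃ s, t ≤ s ∧ σ s = k

/-- `x` is, over the time interval `J`, a state trajectory of the switched network with edgesets
`E k`, switching function `σ` and disturbance realization `d`, controlled by the linear protocol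
with the lazy rule: it is continuous (in particular across the switching times) and satisfies
`ẋ = u` at the other times. At the endpoints of `J` the one-sided equation follows by continuity,
so it is required in the interior only. -/
def IsTrajectoryOn {n : ℕ} {I : Type*} (J : Set ℝ) (E : I → SimpleGraph (Fin n)) (σ : ℝ → I)
    (ξ : ℝ) (d : ℝ → Fin n → Fin n → ℝ) (x : ℝ → Fin n → ℝ) : Prop :=
  ContinuousOn x J ∧
    ∀ t ∈ interior J, t ∉ switchingTimes σ →
      ∃ v, IsLazyControl (E (σ t)) ξ (d t) (x t) v ∧ HasDerivAt x v t

/-- A trajectory over `J` of the network with fixed edgeset `G`. -/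
def IsFixedTrajectoryOn {n : ℕ} (J : Set ℝ) (G : SimpleGraph (Fin n))
    (ξ : ℝ) (d : ℝ → Fin n → Fin n → ℝ) (x : ℝ → Fin n → ℝ) : Prop :=
  IsTrajectoryOn J (fun _ : Unit => G) (fun _ => ()) ξ d x

/-- `𝒱(x)`, the maximum difference between two components of `x`. -/
noncomputable def spread {n : ℕ} (x : Fin n → ℝ) : ℝ :=
  (⨆ i, x i) - ⨅ i, x i

/-- The polyhedron `P(d, E)` of the equilibrium points for the constant disturbance `d`. -/
noncomputable def polyP {n : ℕ} (ξ : ℝ) (d : Fin n → Fin n → ℝ) (G : SimpleGraph (Fin n)) :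
    Set (Fin n → ℝ) :=
  {x | ∀ i,
    -((∑ j ∈ nbrs G i, d i j) / ((nbrs G i).card : ℝ)) - ξ
        ≤ (∑ j ∈ nbrs G i, x j) / ((nbrs G i).card : ℝ) - x i ∧
    (∑ j ∈ nbrs G i, x j) / ((nbrs G i).card : ℝ) - x i
        ≤ -((∑ j ∈ nbrs G i, d i j) / ((nbrs G i).card : ℝ)) + ξ}

/-- `P(Q, E)`, the union of the `P(d, E)` over `d ∈ Q`. -/
noncomputable def setP {n : ℕ} (ξ : ℝ) (Q : Set (Fin n → Fin n → ℝ)) (G : SimpleGraph (Fin n)) :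
    Set (Fin n → ℝ) :=
  ⋃ d ∈ Q, polyP ξ d G

/-- `A + ν`, the points at distance at most `ν` from a point of `A` in the sup norm (which is the
norm of `Fin n → ℝ`). -/
def fatten {n : ℕ} (A : Set (Fin n → ℝ)) (ν : ℝ) : Set (Fin n → ℝ) :=
  {x | ∃ y ∈ A, ‖x - y‖ ≤ ν}

/-- `L(Q, E)`, the maximum of `𝒱` over `P(Q, E)`. -/
noncomputable def maxSpread {n : ℕ} (ξ : ℝ) (Q : Set (Fin n → Fin n → ℝ))
    (G : SimpleGraph (Fin n)) : ℝ :=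
  sSup (spread '' setP ξ Q G)

/-- The tube `S(Q, E, ν)`. -/
noncomputable def tubeS {n : ℕ} (ξ : ℝ) (Q : Set (Fin n → Fin n → ℝ)) (G : SimpleGraph (Fin n))
    (ν : ℝ) : Set (Fin n → ℝ) :=
  {x | spread x ≤ maxSpread ξ Q G + 2 * ν}

/-- `q` is an admissible value of `q(ν, γ)` for the fixed edgeset `G`: it is positive and, from any
initial time `t`, any initial state and under any disturbance realization, within a time `q` either
`𝒱` has dropped below `γ` times its value at `t` or the state has reached `P(D, E) + ν`. -/
def IsSettlingTime {n : ℕ} (G : SimpleGraph (Fin n)) (ξ ν γ q : ℝ) : Prop :=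
  0 < q ∧ ∀ d, IsDisturbance ξ d → ∀ t, 0 ≤ t → ∀ x : ℝ → Fin n → ℝ,
    IsFixedTrajectoryOn (Set.Icc t (t + q)) G ξ d x →
      ∃ s ∈ Set.Icc t (t + q),
        spread (x s) < γ * spread (x t) ∨ x s ∈ fatten (setP ξ (disturbanceBox n ξ) G) ν

/-! Write b_i for `nbrDiff G x i` and m_i for the degree of i. The lazy rule makes v_i the point
nearest 0 of an interval of radius m_i ξ centred at b_i + ∑ d_ij. As |∑ d_ij| ≤ m_i ξ, this interval
contains b_i, so v_i never has the sign opposite to b_i, |v_i| ≤ |b_i| and |v_i - b_i| ≤ 2 m_i ξ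
(`IsLazyControl.bounds`).

Two consequences follow. First, an agent at the maximum cannot be pushed up nor one at the minimum
down, whatever the graph, so the spread never increases, even across switches (`spread_antitoneOn`).
Secondly, the Dirichlet energy has derivative -4 ∑ v_i b_i, with every term v_i b_i nonnegative.
Since P(D, E) is the set where |b_i| ≤ 2 m_i ξ for all i (`mem_setP_iff`), outside P(D, E) + ν some
|b_i| exceeds 2 m_i ξ by δ times the spread (`exists_excess`). The energy then decays at a rate
quadratic in the spread, while it is at most n² times the squared spread; this gives an admissible
time independent of the initial state (`exists_isSettlingTime`).

Under switching, recurrence and the dwell time yield, arbitrarily late, windows where E_k is active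
long enough to multiply the spread by γ or to bring it below L(D, E_k) + 2ν. Finitely many windows
suffice for each k, and monotonicity keeps the bound afterwards. -/

/-- The sum of the differences between the neighbours of `i` and `i`. -/
noncomputable def nbrDiff {n : ℕ} (G : SimpleGraph (Fin n)) (x : Fin n → ℝ) (i : Fin n) : ℝ :=
  ∑ j ∈ nbrs G i, (x j - x i)

/-- The Dirichlet energy of `x`, with each edge counted in both directions. -/
noncomputable def energy {n : ℕ} (G : SimpleGraph (Fin n)) (x : Fin n → ℝ) : ℝ :=
  ∑ i, ∑ j ∈ nbrs G i, (x j - x i) ^ 2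

/-! ### The spread as a Lipschitz seminorm. -/

section Spread

variable {n : ℕ}

theorem sub_le_spread (x : Fin n → ℝ) (i j : Fin n) : x i - x j ≤ spread x :=
  sub_le_sub (le_ciSup (Set.finite_range x).bddAbove i) (ciInf_le (Set.finite_range x).bddBelow j)

theorem abs_sub_le_spread (x : Fin n → ℝ) (i j : Fin n) : |x i - x j| ≤ spread x :=
  abs_sub_le_iff.2 ⟨sub_le_spread x i j, sub_le_spread x j i⟩

theorem exists_spread_eq [NeZero n] (x : Fin n → ℝ) : ∃ i j, spread x = x i - x j := by
  obtain ⟨i, hi⟩ := exists_eq_ciSup_of_finite (f := x)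
  obtain ⟨j, hj⟩ := exists_eq_ciInf_of_finite (f := x)
  exact ⟨i, j, by rw [spread, hi, hj]⟩

theorem spread_nonneg [NeZero n] (x : Fin n → ℝ) : 0 ≤ spread x := by
  simpa using sub_le_spread x 0 0

theorem spread_le_add [NeZero n] (x y : Fin n → ℝ) : spread x ≤ spread y + 2 * ‖x - y‖ := by
  obtain ⟨i, j, h⟩ := exists_spread_eq x
  have hi := abs_le.1 (norm_le_pi_norm (x - y) i)
  have hj := abs_le.1 (norm_le_pi_norm (x - y) j)
  simp only [Pi.sub_apply] at hi hj
  linarith [sub_le_spread y i j, hi.2, hj.1]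

theorem continuous_spread [NeZero n] : Continuous (spread : (Fin n → ℝ) → ℝ) :=
  (LipschitzWith.of_le_add_mul 2 fun x y => by
    simpa [dist_eq_norm] using spread_le_add x y).continuous

end Spread

/-! ### Dirichlet energy and Poincaré-type inequalities on a connected graph. -/

section Graph

variable {n : ℕ} (G : SimpleGraph (Fin n))

theorem mem_nbrs {i j : Fin n} : j ∈ nbrs G i ↔ G.Adj i j := by
  simp [nbrs]

theorem card_nbrs_pos (hn : 2 ≤ n) (hG : G.Connected) (i : Fin n) : 0 < (nbrs G i).card := by
  have : Nontrivial (Fin n) := Fin.nontrivial_iff_two_le.2 hn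
  obtain ⟨j, hj⟩ := hG.preconnected.exists_adj_of_nontrivial i
  exact Finset.card_pos.2 ⟨j, (mem_nbrs G).2 hj⟩

theorem card_nbrs_le (i : Fin n) : ((nbrs G i).card : ℝ) ≤ n := by
  exact_mod_cast (Finset.card_le_univ _).trans_eq (Fintype.card_fin n)

theorem sum_nbrs_comm (f : Fin n → Fin n → ℝ) :
    ∑ i, ∑ j ∈ nbrs G i, f i j = ∑ i, ∑ j ∈ nbrs G i, f j i :=
  Finset.sum_comm' fun i j => by simp [mem_nbrs, G.adj_comm]

/-- Summation by parts, from the symmetry of adjacency. It serves both the bound of the energy by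
neighbour differences and the derivative of the energy. -/
theorem sum_nbrs_sub_mul_sub (x v : Fin n → ℝ) :
    ∑ i, ∑ j ∈ nbrs G i, (x j - x i) * (v j - v i) = -2 * ∑ i, v i * nbrDiff G x i := by
  have h := sum_nbrs_comm G fun i j => (x j - x i) * v j
  simp only [mul_sub, Finset.sum_sub_distrib]
  rw [h, ← Finset.sum_sub_distrib, Finset.mul_sum]
  refine Finset.sum_congr rfl fun i _ => ?_
  rw [nbrDiff, Finset.mul_sum, Finset.mul_sum, ← Finset.sum_sub_distrib]
  exact Finset.sum_congr rfl fun j _ => by ring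

theorem energy_nonneg (x : Fin n → ℝ) : 0 ≤ energy G x :=
  Finset.sum_nonneg fun _ _ => Finset.sum_nonneg fun _ _ => sq_nonneg _

theorem sq_sub_le_energy (x : Fin n → ℝ) {i j : Fin n} (h : G.Adj i j) :
    (x j - x i) ^ 2 ≤ energy G x :=
  (Finset.single_le_sum (f := fun j => (x j - x i) ^ 2) (fun _ _ => sq_nonneg _)
    ((mem_nbrs G).2 h)).trans
    (Finset.single_le_sum (f := fun i => ∑ j ∈ nbrs G i, (x j - x i) ^ 2)
      (fun _ _ => Finset.sum_nonneg fun _ _ => sq_nonneg _) (Finset.mem_univ i))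

theorem energy_le (x : Fin n → ℝ) : energy G x ≤ (n : ℝ) ^ 2 * spread x ^ 2 := by
  have h : ∀ i j, (x j - x i) ^ 2 ≤ spread x ^ 2 := fun i j =>
    sq_le_sq' (neg_le_of_abs_le (abs_sub_le_spread x j i)) (sub_le_spread x j i)
  calc energy G x ≤ ∑ _i : Fin n, ∑ _j : Fin n, spread x ^ 2 :=
        Finset.sum_le_sum fun i _ =>
          (Finset.sum_le_sum_of_subset_of_nonneg (Finset.subset_univ _)
            fun _ _ _ => sq_nonneg _).trans (Finset.sum_le_sum fun j _ => h i j)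
    _ = (n : ℝ) ^ 2 * spread x ^ 2 := by simp; ring

theorem abs_sub_le_length_mul (x : Fin n → ℝ) {M : ℝ} (hM : ∀ i j, G.Adj i j → |x j - x i| ≤ M)
    {i j : Fin n} (p : G.Walk i j) : |x j - x i| ≤ p.length * M := by
  induction p with
  | nil => simp
  | cons h p ih =>
    rename_i u v w
    rw [SimpleGraph.Walk.length_cons]
    push_cast
    linarith [abs_sub_le (x w) (x v) (x u), hM _ _ h]

/-- A path from a minimizer to a maximizer has fewer than n edges, and each edge contributes at most
the square root of the energy. -/
theorem sq_spread_le_energy [NeZero n] (hG : G.Connected) (x : Fin n → ℝ) :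
    spread x ^ 2 ≤ (n : ℝ) ^ 2 * energy G x := by
  obtain ⟨i, j, h⟩ := exists_spread_eq x
  obtain ⟨p, hp⟩ := (hG.preconnected j i).exists_isPath
  have hlen : (p.length : ℝ) ≤ n := by
    exact_mod_cast (hp.length_lt.le.trans_eq (Fintype.card_fin n))
  have hM : ∀ i j, G.Adj i j → |x j - x i| ≤ √(energy G x) := fun i j hij =>
    Real.abs_le_sqrt (sq_sub_le_energy G x hij)
  have h1 := (le_abs_self _).trans (abs_sub_le_length_mul G x hM p)
  rw [← h] at h1
  have h2 : spread x ≤ n * √(energy G x) :=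
    h1.trans (mul_le_mul_of_nonneg_right hlen (Real.sqrt_nonneg _))
  calc spread x ^ 2 ≤ (n * √(energy G x)) ^ 2 := pow_le_pow_left₀ (spread_nonneg x) h2 2
    _ = _ := by rw [mul_pow, Real.sq_sqrt (energy_nonneg G x)]

/-- On a connected graph the differences with the neighbours control the spread. -/
theorem spread_le_of_abs_nbrDiff_le [NeZero n] (hG : G.Connected) (x : Fin n → ℝ) {B : ℝ}
    (hB : ∀ i, |nbrDiff G x i| ≤ B) : spread x ≤ 2 * (n : ℝ) ^ 3 * B := by
  have hB0 : 0 ≤ B := (abs_nonneg _).trans (hB 0)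
  have hV := spread_nonneg x
  -- Subtracting x 0 leaves the energy unchanged and bounds the weights by the spread, so that V² ≤
  -- n² · energy ≤ 2n³ V B.
  have h1 : energy G x = -2 * ∑ i, (x i - x 0) * nbrDiff G x i := by
    rw [← sum_nbrs_sub_mul_sub G x (fun i => x i - x 0)]
    exact Finset.sum_congr rfl fun i _ => Finset.sum_congr rfl fun j _ => by ring
  have h2 : -∑ i, (x i - x 0) * nbrDiff G x i ≤ n * (spread x * B) := by
    rw [← Finset.sum_neg_distrib]
    calc ∑ i, -((x i - x 0) * nbrDiff G x i) ≤ ∑ _i : Fin n, spread x * B := by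
          refine Finset.sum_le_sum fun i _ => (neg_le_abs _).trans ?_
          rw [abs_mul]
          exact mul_le_mul (abs_sub_le_spread x i 0) (hB i) (abs_nonneg _) hV
      _ = _ := by simp
  have h3 := sq_spread_le_energy G hG x
  have h4 : spread x * spread x ≤ (2 * (n : ℝ) ^ 3 * B) * spread x := by
    have : (n : ℝ) ^ 2 * energy G x ≤ (n : ℝ) ^ 2 * (2 * (n * (spread x * B))) :=
      mul_le_mul_of_nonneg_left (by linarith) (by positivity)
    nlinarith
  rcases hV.eq_or_lt with h0 | h0
  · rw [← h0]; positivity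
  · exact le_of_mul_le_mul_right h4 h0

end Graph

/-! ### Sign and size of the lazy control. -/

section Control

variable {n : ℕ} {G : SimpleGraph (Fin n)} {ξ : ℝ}

theorem abs_sum_nbrs_disturbance_le {d : Fin n → Fin n → ℝ} (hd : d ∈ disturbanceBox n ξ)
    (i : Fin n) : |∑ j ∈ nbrs G i, d i j| ≤ (nbrs G i).card * ξ := by
  refine (Finset.abs_sum_le_sum_abs _ _).trans ?_
  simpa using Finset.sum_le_card_nsmul (nbrs G i) (fun j => |d i j|) ξ
    fun j _ => abs_le.2 (hd i j)

/-- The sum of the lazy estimates is the point of smallest absolute value of an interval. -/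
theorem IsLazyEstimate.abs_sum_le {N : Finset (Fin n)} (hN : 0 < N.card) {xi : ℝ}
    {y z : Fin n → ℝ} (h : IsLazyEstimate N ξ xi y z) {r : ℝ}
    (hr : |r - ∑ j ∈ N, (y j - xi)| ≤ N.card * ξ) : |∑ j ∈ N, (z j - xi)| ≤ |r| := by
  have hm : (0 : ℝ) < N.card := by exact_mod_cast hN
  set e := (r - ∑ j ∈ N, (y j - xi)) / N.card with he
  -- Shifting every measure by the same e is compatible and realizes the sum r.
  have hle : |e| ≤ ξ := by
    rw [he, abs_div, abs_of_pos hm, div_le_iff₀ hm]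
    linarith
  have hw : (fun j => y j + e) ∈ candidateEstimates N ξ y := fun j _ =>
    ⟨by linarith [(abs_le.1 hle).1], by linarith [(abs_le.1 hle).2]⟩
  have := isMinOn_iff.1 h.2 _ hw
  have hs : ∑ j ∈ N, (y j + e - xi) = r := by
    rw [show (fun j => y j + e - xi) = fun j => (y j - xi) + e from funext fun _ => by ring,
      Finset.sum_add_distrib, Finset.sum_const, nsmul_eq_mul, he]
    field_simp
    ring
  rwa [hs] at this

theorem IsLazyEstimate.abs_sum_sub_le {N : Finset (Fin n)} {xi : ℝ} {y z : Fin n → ℝ}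
    (h : IsLazyEstimate N ξ xi y z) :
    |∑ j ∈ N, (z j - xi) - ∑ j ∈ N, (y j - xi)| ≤ N.card * ξ := by
  rw [← Finset.sum_sub_distrib]
  refine (Finset.abs_sum_le_sum_abs _ _).trans ?_
  simpa using Finset.sum_le_card_nsmul N (fun j => |z j - xi - (y j - xi)|) ξ fun j hj =>
    abs_le.2 ⟨by linarith [(h.1 j hj).1], by linarith [(h.1 j hj).2]⟩

theorem IsLazyControl.bounds {d : Fin n → Fin n → ℝ} {x v : Fin n → ℝ}
    (h : IsLazyControl G ξ d x v) (hd : d ∈ disturbanceBox n ξ)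
    {i : Fin n} (hm : 0 < (nbrs G i).card) :
    |v i - nbrDiff G x i| ≤ 2 * (nbrs G i).card * ξ ∧ |v i| ≤ |nbrDiff G x i| ∧
      0 ≤ v i * nbrDiff G x i := by
  obtain ⟨z, hz, hv⟩ := h i
  have hD := abs_sum_nbrs_disturbance_le (G := G) hd i
  have hy : ∑ j ∈ nbrs G i, (x j + d i j - x i) = nbrDiff G x i + ∑ j ∈ nbrs G i, d i j := by
    rw [nbrDiff, ← Finset.sum_add_distrib]
    exact Finset.sum_congr rfl fun j _ => by ring
  have h1 := hz.abs_sum_sub_le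
  have h2 : ∀ r : ℝ, _ → _ := fun r hr => hz.abs_sum_le hm (r := r) hr
  rw [hy, ← hv] at h1
  simp only [hy, ← hv] at h2
  have h3 := h2 (nbrDiff G x i) (by rw [sub_add_cancel_left, abs_neg]; exact hD)
  refine ⟨?_, h3, ?_⟩
  · have := abs_add_le (v i - (nbrDiff G x i + ∑ j ∈ nbrs G i, d i j)) (∑ j ∈ nbrs G i, d i j)
    rw [show v i - (nbrDiff G x i + ∑ j ∈ nbrs G i, d i j) + ∑ j ∈ nbrs G i, d i j
      = v i - nbrDiff G x i by ring] at this
    linarith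
  -- With strictly opposite signs, 0 lies between v i and the neighbour difference, both attainable
  -- sums; hence 0 is attainable and minimality forces v i = 0.
  · by_contra! hneg
    rw [abs_le] at h1 hD
    have h0 := h2 0 (by
      rw [abs_le]
      rcases mul_neg_iff.1 hneg with h | h <;> constructor <;> linarith)
    rw [abs_zero, abs_nonpos_iff] at h0
    rw [h0, zero_mul] at hneg
    exact lt_irrefl _ hneg

/-- The bounds do not involve the graph, which is what lets the maximum principle ignore the active
edgeset. -/
theorem IsLazyControl.le_sum_max {d : Fin n → Fin n → ℝ} {x v : Fin n → ℝ}
    (h : IsLazyControl G ξ d x v) (hd : d ∈ disturbanceBox n ξ)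
    {i : Fin n} (hm : 0 < (nbrs G i).card) :
    v i ≤ ∑ j, max (x j - x i) 0 ∧ -v i ≤ ∑ j, max (x i - x j) 0 := by
  obtain ⟨-, h2, h3⟩ := h.bounds hd hm
  have hs : ∀ y : Fin n → ℝ, ∑ j ∈ nbrs G i, y j ≤ ∑ j, max (y j) 0 := fun y =>
    (Finset.sum_le_sum fun j _ => le_max_left _ _).trans
      (Finset.sum_le_sum_of_subset_of_nonneg (Finset.subset_univ _) fun _ _ _ => le_max_right _ _)
  have hp : nbrDiff G x i ≤ ∑ j, max (x j - x i) 0 := hs _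
  have hn : -nbrDiff G x i ≤ ∑ j, max (x i - x j) 0 := by
    refine le_trans (le_of_eq ?_) (hs _)
    rw [nbrDiff, ← Finset.sum_neg_distrib]
    exact Finset.sum_congr rfl fun j _ => by ring
  have h0 : ∀ y : Fin n → ℝ, 0 ≤ ∑ j, max (y j) 0 := fun y =>
    Finset.sum_nonneg fun _ _ => le_max_right _ _
  have hp0 := h0 fun j => x j - x i
  have hn0 := h0 fun j => x i - x j
  rcases lt_trichotomy (nbrDiff G x i) 0 with hb | hb | hb
  · have hv : v i ≤ 0 := by by_contra! hv; nlinarith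
    rw [abs_of_neg hb, abs_of_nonpos hv] at h2
    constructor <;> linarith
  · rw [hb, abs_zero, abs_nonpos_iff] at h2
    rw [h2]
    constructor <;> linarith
  · have hv : 0 ≤ v i := by by_contra! hv; nlinarith
    rw [abs_of_pos hb, abs_of_nonneg hv] at h2
    constructor <;> linarith

theorem IsLazyControl.mul_sub_le_mul {d : Fin n → Fin n → ℝ} {x v : Fin n → ℝ}
    (h : IsLazyControl G ξ d x v) (hd : d ∈ disturbanceBox n ξ)
    {i : Fin n} (hm : 0 < (nbrs G i).card) :
    |nbrDiff G x i| * (|nbrDiff G x i| - 2 * (nbrs G i).card * ξ) ≤ v i * nbrDiff G x i := by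
  have h1 := mul_le_mul_of_nonneg_left (h.bounds hd hm).1 (abs_nonneg (nbrDiff G x i))
  rw [← abs_mul] at h1
  have h2 := (abs_le.1 h1).1
  nlinarith [abs_mul_abs_self (nbrDiff G x i)]

end Control

/-! ### The equilibrium set and its neighbourhood. -/

section Polyhedron

variable {n : ℕ} {G : SimpleGraph (Fin n)} {ξ : ℝ}

theorem sum_nbrs_div_sub {i : Fin n} (hm : 0 < (nbrs G i).card) (x : Fin n → ℝ) :
    (∑ j ∈ nbrs G i, x j) / ((nbrs G i).card : ℝ) - x i
      = nbrDiff G x i / ((nbrs G i).card : ℝ) := by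
  have hm : (0 : ℝ) < (nbrs G i).card := by exact_mod_cast hm
  rw [nbrDiff, Finset.sum_sub_distrib, Finset.sum_const, nsmul_eq_mul]
  field_simp

theorem mem_setP_iff (hm : ∀ i, 0 < (nbrs G i).card) (x : Fin n → ℝ) :
    x ∈ setP ξ (disturbanceBox n ξ) G ↔ ∀ i, |nbrDiff G x i| ≤ 2 * (nbrs G i).card * ξ := by
  have hm' : ∀ i, (0 : ℝ) < (nbrs G i).card := fun i => by exact_mod_cast hm i
  simp only [setP, Set.mem_iUnion, polyP, Set.mem_ofPred_eq, sum_nbrs_div_sub (hm _)]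
  constructor
  · rintro ⟨d, hd, h⟩ i
    obtain ⟨h1, h2⟩ := h i
    have hD := abs_le.1 (abs_sum_nbrs_disturbance_le (G := G) hd i)
    have e := hm' i
    rw [← sub_nonneg] at h1 h2
    have h1' := mul_nonneg e.le h1
    have h2' := mul_nonneg e.le h2
    field_simp at h1' h2'
    rw [abs_le]
    constructor <;> nlinarith
  · intro h
    have hb : ∀ i, |nbrDiff G x i / (nbrs G i).card| ≤ 2 * ξ := fun i => by
      rw [abs_div, abs_of_pos (hm' i), div_le_iff₀ (hm' i)]
      linarith [h i]
    -- The average difference lies in [-2ξ, 2ξ]: half of it is absorbed by a disturbance constant in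
    -- j, the other half by the tolerance ξ.
    refine ⟨fun i _ => -(nbrDiff G x i / (nbrs G i).card) / 2, fun i j => ?_, fun i => ?_⟩
    · have := abs_le.1 (hb i)
      constructor <;> linarith
    · have := abs_le.1 (hb i)
      have e := (hm' i).ne'
      rw [Finset.sum_const, nsmul_eq_mul, mul_div_cancel_left₀ _ e]
      constructor <;> linarith

theorem nbrDiff_affine (x : Fin n → ℝ) (c l : ℝ) (i : Fin n) :
    nbrDiff G (fun j => c + l * (x j - c)) i = l * nbrDiff G x i := by
  rw [nbrDiff, nbrDiff, Finset.mul_sum]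
  exact Finset.sum_congr rfl fun j _ => by ring

theorem nbrDiff_const (c : ℝ) (i : Fin n) : nbrDiff G (fun _ => c) i = 0 := by
  simp [nbrDiff]

theorem continuous_nbrDiff (i : Fin n) : Continuous fun x => nbrDiff G x i := by
  unfold nbrDiff
  fun_prop

theorem isGreatest_maxSpread (hn : 2 ≤ n) (hG : G.Connected) (hξ : 0 < ξ) :
    IsGreatest (spread '' setP ξ (disturbanceBox n ξ) G)
      (maxSpread ξ (disturbanceBox n ξ) G) := by
  have : NeZero n := ⟨by omega⟩
  have hm := card_nbrs_pos G hn hG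
  set R := 2 * (n : ℝ) ^ 3 * (2 * n * ξ)
  have hR : ∀ x ∈ setP ξ (disturbanceBox n ξ) G, spread x ≤ R := fun x hx => by
    refine spread_le_of_abs_nbrDiff_le G hG x fun i => ((mem_setP_iff hm x).1 hx i).trans ?_
    have := card_nbrs_le G i
    gcongr
  have hcont : IsClosed (setP ξ (disturbanceBox n ξ) G) := by
    rw [show setP ξ (disturbanceBox n ξ) G
      = ⋂ i, {x | |nbrDiff G x i| ≤ 2 * (nbrs G i).card * ξ} by
        ext x; rw [mem_setP_iff hm, Set.mem_iInter]; rfl]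
    exact isClosed_iInter fun i => isClosed_le (continuous_nbrDiff i).abs continuous_const
  have hK : IsCompact (Set.Icc (fun _ => -R) (fun _ => R) ∩ setP ξ (disturbanceBox n ξ) G) :=
    isCompact_Icc.inter_right hcont
  have hR0 : 0 ≤ R := by positivity
  obtain ⟨x, hx, hmax⟩ := hK.exists_isMaxOn
    ⟨fun _ => 0, ⟨fun _ => by simpa using hR0, fun _ => hR0⟩, (mem_setP_iff hm _).2 fun i => by
      rw [nbrDiff_const, abs_zero]; positivity⟩ continuous_spread.continuousOn
  have hg : IsGreatest (spread '' setP ξ (disturbanceBox n ξ) G) (spread x) := by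
    refine ⟨⟨x, hx.2, rfl⟩, ?_⟩
    rintro _ ⟨y, hy, rfl⟩
    -- The set is unbounded but invariant under adding constants, so normalizing coordinate 0 to
    -- zero moves y into the compact part.
    have hb : ∀ i, |y i - y 0| ≤ R := fun i => (abs_sub_le_spread y i 0).trans (hR y hy)
    have hs : spread y ≤ spread fun j => y j - y 0 := by
      obtain ⟨i, j, h⟩ := exists_spread_eq y
      have := sub_le_spread (fun j => y j - y 0) i j
      linarith
    refine hs.trans (isMaxOn_iff.1 hmax _ ⟨⟨fun i => (abs_le.1 (hb i)).1,
      fun i => (abs_le.1 (hb i)).2⟩, (mem_setP_iff hm _).2 fun i => ?_⟩)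
    refine le_trans (le_of_eq ?_) ((mem_setP_iff hm y).1 hy i)
    simp [nbrDiff]
  rw [maxSpread, hg.csSup_eq]
  exact hg

theorem maxSpread_nonneg (hn : 2 ≤ n) (hG : G.Connected) (hξ : 0 < ξ) :
    0 ≤ maxSpread ξ (disturbanceBox n ξ) G := by
  have : NeZero n := ⟨by omega⟩
  obtain ⟨x, -, hx⟩ := (isGreatest_maxSpread hn hG hξ).1
  exact hx ▸ spread_nonneg x

/-- Outside `P(D, E) + ν`, some neighbour difference exceeds the range of the estimates by an
amount proportional to the spread. -/
theorem exists_excess (hn : 2 ≤ n) (hG : G.Connected) (hξ : 0 < ξ) {ν : ℝ} (hν : 0 < ν) :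
    ∃ δ > 0, ∀ x, x ∉ fatten (setP ξ (disturbanceBox n ξ) G) ν →
      ∃ i, 2 * (nbrs G i).card * ξ + δ * spread x < |nbrDiff G x i| := by
  have : NeZero n := ⟨by omega⟩
  have hm := card_nbrs_pos G hn hG
  have hn0 : (0 : ℝ) < n := by exact_mod_cast (by omega : 0 < n)
  set R := 8 * (n : ℝ) ^ 4 * ξ
  have hR : 0 < R := by positivity
  -- If no excess occurs, V ≤ 2n³(2nξ + δV); the first bound on δ absorbs half of V and gives V ≤ R.
  -- The second makes the displacement of the contraction below at most δV²/(2ξ) ≤ ν.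
  refine ⟨min (1 / (4 * (n : ℝ) ^ 3)) (2 * ξ * ν / R ^ 2), by positivity, fun x hx => ?_⟩
  set δ := min (1 / (4 * (n : ℝ) ^ 3)) (2 * ξ * ν / R ^ 2)
  have hδ : 0 < δ := by positivity
  have hδ1 : δ * (4 * (n : ℝ) ^ 3) ≤ 1 := (le_div_iff₀ (by positivity)).1 (min_le_left _ _)
  have hδ2 : δ * R ^ 2 ≤ 2 * ξ * ν := (le_div_iff₀ (by positivity)).1 (min_le_right _ _)
  by_contra! hb
  refine hx ?_
  have hV := spread_nonneg x
  have hVR : spread x ≤ R := by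
    have h := spread_le_of_abs_nbrDiff_le G hG x (B := 2 * n * ξ + δ * spread x) fun i =>
      (hb i).trans (by have := card_nbrs_le G i; gcongr)
    have := mul_le_mul_of_nonneg_right hδ1 hV
    simp only [R]
    nlinarith
  -- Contracting x towards the constant vector x 0 by l scales every neighbour difference by l; as
  -- degrees are at least 1, this lands in P(D, E).
  set l := 2 * ξ / (2 * ξ + δ * spread x) with hl
  have hden : 0 < 2 * ξ + δ * spread x := by positivity
  have hl0 : 0 ≤ l := by positivity
  have hl1 : 1 - l = δ * spread x / (2 * ξ + δ * spread x) := by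
    rw [hl]; field_simp; ring
  refine ⟨fun j => x 0 + l * (x j - x 0), (mem_setP_iff hm _).2 fun i => ?_, ?_⟩
  · rw [nbrDiff_affine, abs_mul, abs_of_nonneg hl0, hl, div_mul_eq_mul_div, div_le_iff₀ hden]
    have h1 : (1 : ℝ) ≤ (nbrs G i).card := by exact_mod_cast hm i
    have h2 : δ * spread x ≤ (nbrs G i).card * (δ * spread x) :=
      le_mul_of_one_le_left (by positivity) h1
    nlinarith [mul_le_mul_of_nonneg_left (hb i) hξ.le, mul_le_mul_of_nonneg_left h2 hξ.le]
  · rw [pi_norm_le_iff_of_nonneg hν.le]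
    intro i
    have h1 : 0 ≤ 1 - l := by rw [hl1]; positivity
    rw [Pi.sub_apply, show x i - (x 0 + l * (x i - x 0)) = (1 - l) * (x i - x 0) by ring,
      Real.norm_eq_abs, abs_mul, abs_of_nonneg h1]
    refine (mul_le_mul_of_nonneg_left (abs_sub_le_spread x i 0) h1).trans ?_
    rw [hl1, div_mul_eq_mul_div, div_le_iff₀ hden]
    have h2 : spread x ^ 2 ≤ R ^ 2 := pow_le_pow_left₀ hV hVR 2
    nlinarith [mul_le_mul_of_nonneg_left h2 hδ.le, mul_nonneg hδ.le hV]

end Polyhedron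

/-! ### Maximum principle, energy decay and settling time for a fixed graph. -/

section Dynamics

variable {n : ℕ}

theorem hasDerivAt_sq_max_zero (y : ℝ) :
    HasDerivAt (fun y : ℝ => max y 0 ^ 2) (2 * max y 0) y := by
  rcases lt_trichotomy y 0 with h | rfl | h
  · rw [max_eq_right h.le, mul_zero]
    refine (hasDerivAt_const y (0 : ℝ)).congr_of_eventuallyEq ?_
    filter_upwards [gt_mem_nhds h] with z hz
    simp [max_eq_right hz.le]
  · have : HasFDerivAt (fun y : ℝ => max y 0 ^ 2) (0 : ℝ →L[ℝ] ℝ) 0 := by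
      refine Asymptotics.IsBigO.hasFDerivAt (n := 2) (Asymptotics.IsBigO.of_bound 1 ?_) one_lt_two
      refine Eventually.of_forall fun z => ?_
      rw [one_mul, sub_zero, norm_pow, norm_pow, norm_norm, Real.norm_eq_abs, Real.norm_eq_abs,
        abs_of_nonneg (le_max_right z 0)]
      exact pow_le_pow_left₀ (le_max_right _ _) (max_le (le_abs_self _) (abs_nonneg _)) 2
    simpa using this.hasDerivAt
  · rw [max_eq_left h.le]
    have := hasDerivAt_pow 2 y
    simp only [Nat.cast_ofNat, Nat.add_one_sub_one, pow_one] at this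
    refine this.congr_of_eventuallyEq ?_
    filter_upwards [lt_mem_nhds h] with z hz
    rw [max_eq_left hz.le]

/-- The maximum principle for averaging dynamics. -/
theorem le_of_forall_hasDerivAt_le_sum_max {a b : ℝ} (hab : a ≤ b) {x : ℝ → Fin n → ℝ}
    (hx : ContinuousOn x (Set.Icc a b))
    (hd : ∀ t ∈ Set.Ioo a b, ∃ v, HasDerivAt x v t ∧ ∀ i, v i ≤ ∑ j, max (x t j - x t i) 0)
    {c : ℝ} (hc : ∀ i, x a i ≤ c) (i : Fin n) : x b i ≤ c := by
  choose! v hv hvle using hd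
  -- The squared positive parts are differentiable, unlike the maximum. Only the i with x i > c
  -- contribute, and Φ' ≤ 2nΦ with Φ a = 0 gives Φ b = 0 by Grönwall's argument.
  set Φ : ℝ → ℝ := fun t => ∑ i, max (x t i - c) 0 ^ 2
  have hΦ : ∀ t ∈ Set.Ioo a b,
      HasDerivAt Φ (∑ i, 2 * max (x t i - c) 0 * v t i) t := fun t ht => by
    refine HasDerivAt.fun_sum fun i _ => ?_
    have h1 := ((hasDerivAt_pi.1 (hv t ht)) i).sub_const c
    exact (hasDerivAt_sq_max_zero _).comp t h1
  have hle : ∀ t ∈ Set.Ioo a b, ∑ i, 2 * max (x t i - c) 0 * v t i ≤ 2 * n * Φ t :=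
      fun t ht => by
    have h1 : ∀ i, 2 * max (x t i - c) 0 * v t i
        ≤ 2 * (max (x t i - c) 0 * ∑ j, max (x t j - c) 0) := fun i => by
      rcases le_or_gt (x t i) c with h | h
      · rw [max_eq_right (sub_nonpos.2 h)]; simp
      · rw [mul_assoc]
        have : v t i ≤ ∑ j, max (x t j - c) 0 := (hvle t ht i).trans
          (Finset.sum_le_sum fun j _ => max_le_max_right _ (by linarith))
        have h0 := le_max_right (x t i - c) 0
        gcongr
    have h2 := sq_sum_le_card_mul_sum_sq (s := Finset.univ) (f := fun i => max (x t i - c) 0)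
    simp only [Finset.card_univ, Fintype.card_fin] at h2
    calc _ ≤ ∑ i, 2 * (max (x t i - c) 0 * ∑ j, max (x t j - c) 0) :=
          Finset.sum_le_sum fun i _ => h1 i
      _ = 2 * (∑ j, max (x t j - c) 0) ^ 2 := by
          rw [← Finset.mul_sum, ← Finset.sum_mul]; ring
      _ ≤ _ := by simp only [Φ]; linarith
  have hanti : AntitoneOn (fun t => Real.exp (-(2 * n) * t) * Φ t) (Set.Icc a b) := by
    have hcont : ContinuousOn (fun t => Real.exp (-(2 * n) * t) * Φ t) (Set.Icc a b) := by
      have := continuousOn_pi.1 hx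
      fun_prop
    refine antitoneOn_of_hasDerivWithinAt_nonpos (convex_Icc a b) hcont
      (f' := fun t => Real.exp (-(2 * n) * t) * (∑ i, 2 * max (x t i - c) 0 * v t i - 2 * n * Φ t))
      (fun t ht => ?_) fun t ht => ?_
    · rw [interior_Icc] at ht
      have h1 : HasDerivAt (fun t : ℝ => Real.exp (-(2 * n) * t))
          (Real.exp (-(2 * n) * t) * -(2 * n)) t := by
        simpa using ((hasDerivAt_id t).const_mul (-(2 * (n : ℝ)))).exp
      refine HasDerivAt.hasDerivWithinAt ?_
      refine (h1.mul (hΦ t ht)).congr_deriv ?_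
      ring
    · rw [interior_Icc] at ht
      exact mul_nonpos_of_nonneg_of_nonpos (Real.exp_pos _).le (sub_nonpos.2 (hle t ht))
  have h := hanti (Set.left_mem_Icc.2 hab) (Set.right_mem_Icc.2 hab) hab
  have ha : Φ a = 0 := Finset.sum_eq_zero fun i _ => by
    rw [max_eq_right (sub_nonpos.2 (hc i))]; simp
  simp only [ha, mul_zero] at h
  have hb : Φ b ≤ 0 := by
    by_contra! hb
    exact absurd h (not_le.2 (mul_pos (Real.exp_pos _) hb))
  have h3 : max (x b i - c) 0 ^ 2 ≤ 0 :=
    (Finset.single_le_sum (f := fun i => max (x b i - c) 0 ^ 2) (fun _ _ => sq_nonneg _)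
      (Finset.mem_univ i)).trans hb
  have h4 : max (x b i - c) 0 = 0 := pow_eq_zero_iff two_ne_zero |>.1 (h3.antisymm (sq_nonneg _))
  linarith [le_max_left (x b i - c) 0]

theorem spread_le_spread_of_hasDerivAt [NeZero n] {a b : ℝ} (hab : a ≤ b) {x : ℝ → Fin n → ℝ}
    (hx : ContinuousOn x (Set.Icc a b))
    (hd : ∀ t ∈ Set.Ioo a b, ∃ v, HasDerivAt x v t ∧
      ∀ i, v i ≤ ∑ j, max (x t j - x t i) 0 ∧ -v i ≤ ∑ j, max (x t i - x t j) 0) :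
    spread (x b) ≤ spread (x a) := by
  have h1 := le_of_forall_hasDerivAt_le_sum_max hab hx
    (fun t ht => (hd t ht).imp fun v hv => ⟨hv.1, fun i => (hv.2 i).1⟩)
    (c := ⨆ i, x a i) (le_ciSup (Set.finite_range _).bddAbove)
  have h2 := le_of_forall_hasDerivAt_le_sum_max hab hx.neg
    (fun t ht => by
      obtain ⟨v, hv, hle⟩ := hd t ht
      refine ⟨-v, hv.neg, fun i => (hle i).2.trans_eq (Finset.sum_congr rfl fun j _ => ?_)⟩
      simp only [Pi.neg_apply]
      congr 1
      ring)
    (c := -⨅ i, x a i) (fun i => neg_le_neg (ciInf_le (Set.finite_range _).bddBelow i))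
  obtain ⟨i, j, h⟩ := exists_spread_eq (x b)
  have := h2 j
  simp only [Pi.neg_apply] at this
  rw [h, spread]
  linarith [h1 i]

theorem hasDerivAt_energy (G : SimpleGraph (Fin n)) {x : ℝ → Fin n → ℝ} {v : Fin n → ℝ} {t : ℝ}
    (h : HasDerivAt x v t) :
    HasDerivAt (fun t => energy G (x t)) (-4 * ∑ i, v i * nbrDiff G (x t) i) t := by
  have h1 : HasDerivAt (fun t => energy G (x t))
      (∑ i, ∑ j ∈ nbrs G i, 2 * ((x t j - x t i) * (v j - v i))) t := by
    unfold energy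
    refine HasDerivAt.fun_sum fun i _ => HasDerivAt.fun_sum fun j _ => ?_
    have := ((hasDerivAt_pi.1 h j).sub (hasDerivAt_pi.1 h i)).pow 2
    refine this.congr_deriv ?_
    simp only [Pi.sub_apply, Nat.cast_ofNat, Nat.add_one_sub_one, pow_one]
    ring
  convert h1 using 1
  simp only [← Finset.mul_sum]
  rw [sum_nbrs_sub_mul_sub]
  ring

theorem continuous_energy (G : SimpleGraph (Fin n)) : Continuous (energy G) := by
  unfold energy
  fun_prop

theorem exists_isSettlingTime (hn : 2 ≤ n) {G : SimpleGraph (Fin n)} (hG : G.Connected)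
    {ξ ν γ : ℝ} (hξ : 0 < ξ) (hν : 0 < ν) (hγ : 0 < γ) : ∃ q, IsSettlingTime G ξ ν γ q := by
  have : NeZero n := ⟨by omega⟩
  have hm := card_nbrs_pos G hn hG
  have hn0 : (0 : ℝ) < n := by exact_mod_cast (by omega : 0 < n)
  obtain ⟨δ, hδ, hex⟩ := exists_excess hn hG hξ hν
  -- Over time q the energy would lose 4n² V², with V the initial spread, though it starts at no
  -- more than n² V². Hence V = 0, which contradicts the excess at time t.
  set q : ℝ := (n : ℝ) ^ 2 / (δ * γ) ^ 2 with hq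
  have hq0 : 0 < q := by positivity
  refine ⟨q, hq0, fun d hd t ht x hx => ?_⟩
  by_contra! hno
  have hV := spread_nonneg (x t)
  set c := 4 * (δ * (γ * spread (x t))) ^ 2 with hc
  have hdec : ∀ s ∈ Set.Ioo t (t + q), ∃ e, HasDerivAt (fun s => energy G (x s)) e s ∧ e ≤ -c := by
    intro s hs
    obtain ⟨v, hv, hder⟩ := hx.2 s (by rwa [interior_Icc]) (by
      rintro ⟨-, k, l, hkl, -⟩; exact hkl rfl)
    refine ⟨_, hasDerivAt_energy G hder, ?_⟩
    obtain ⟨h1, h2⟩ := hno s (Set.Ioo_subset_Icc_self hs)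
    obtain ⟨i, hi⟩ := hex _ h2
    have hds := hd.2 s (ht.trans hs.1.le)
    have hle : v i * nbrDiff G (x s) i ≤ ∑ i, v i * nbrDiff G (x s) i :=
      Finset.single_le_sum (f := fun i => v i * nbrDiff G (x s) i)
        (fun i _ => (hv.bounds hds (hm i)).2.2) (Finset.mem_univ i)
    have h3 := hv.mul_sub_le_mul hds (hm i)
    have h4 : δ * (γ * spread (x t)) ≤ δ * spread (x s) := by gcongr
    have h5 : 0 ≤ δ * (γ * spread (x t)) := by positivity
    have h6 : 0 ≤ 2 * ((nbrs G i).card : ℝ) * ξ := by positivity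
    have h7 : (δ * (γ * spread (x t))) * (δ * (γ * spread (x t)))
        ≤ |nbrDiff G (x s) i| * (|nbrDiff G (x s) i| - 2 * (nbrs G i).card * ξ) :=
      mul_le_mul (by linarith) (by linarith) h5 (abs_nonneg _)
    rw [hc]
    nlinarith
  choose! e he hele using hdec
  have hanti : AntitoneOn (fun s => energy G (x s) + c * s) (Set.Icc t (t + q)) := by
    refine antitoneOn_of_hasDerivWithinAt_nonpos (convex_Icc _ _)
      (((continuous_energy G).comp_continuousOn hx.1).add (by fun_prop))
      (f' := fun s => e s + c * 1) (fun s hs => ?_) fun s hs => ?_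
    · rw [interior_Icc] at hs
      exact ((he s hs).add ((hasDerivAt_id s).const_mul c)).hasDerivWithinAt
    · rw [interior_Icc] at hs
      linarith [hele s hs]
  have h := hanti (Set.left_mem_Icc.2 (by linarith)) (Set.right_mem_Icc.2 (by linarith))
    (by linarith : t ≤ t + q)
  simp only at h
  have h1 := energy_le G (x t)
  have h2 := energy_nonneg G (x (t + q))
  have h3 : c * q = 4 * ((n : ℝ) ^ 2 * spread (x t) ^ 2) := by
    rw [hc, hq]; field_simp
  have h4 : spread (x t) = 0 := by
    have : (n : ℝ) ^ 2 * spread (x t) ^ 2 ≤ 0 := by nlinarith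
    have h5 : spread (x t) ^ 2 = 0 :=
      le_antisymm (nonpos_of_mul_nonpos_right this (by positivity)) (sq_nonneg _)
    exact pow_eq_zero_iff two_ne_zero |>.1 h5
  obtain ⟨i, hi⟩ := hex _ (hno t (Set.left_mem_Icc.2 (by linarith))).2
  have h5 : nbrDiff G (x t) i = 0 := Finset.sum_eq_zero fun j _ =>
    abs_nonpos_iff.1 ((abs_sub_le_spread (x t) j i).trans_eq h4)
  rw [h5, h4, abs_zero] at hi
  have : 0 ≤ 2 * ((nbrs G i).card : ℝ) * ξ := by positivity
  linarith

end Dynamics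

/-! ### Dwell-time windows and convergence under switching. -/

section Switching

variable {I : Type*} {σ : ℝ → I}

theorem IsSwitchingFunction.eq_of_forall_notMem (hσ : IsSwitchingFunction σ) {a b : ℝ}
    (ha : 0 ≤ a) (h : ∀ t ∈ Set.Ioc a b, t ∉ switchingTimes σ) {t : ℝ} (ht : t ∈ Set.Icc a b) :
    σ t = σ a := by
  -- For the discrete topology, absence of switching means continuity, and an interval is connected.
  let _ : TopologicalSpace I := ⊥
  have : DiscreteTopology I := ⟨rfl⟩
  have hcont : ContinuousOn σ (Set.Icc a b) := by
    intro s hs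
    rw [ContinuousWithinAt, nhds_discrete, tendsto_pure]
    have hr := hσ.1 s (ha.trans hs.1)
    rcases hs.1.eq_or_lt with rfl | has
    · refine Eventually.filter_mono
        (nhdsWithin_mono a (Set.Icc_subset_Ici_self.trans_eq Set.Ioi_insert.symm)) ?_
      rw [nhdsWithin_insert, eventually_sup]
      exact ⟨rfl, hr⟩
    · obtain ⟨k, hk⟩ := hσ.2 s (ha.trans_lt has)
      have hks : k = σ s := by
        by_contra hne
        exact h s ⟨has, hs.2⟩ ⟨ha.trans_lt has, k, σ s, hne, hk, hr⟩
      subst hks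
      refine Eventually.filter_mono nhdsWithin_le_nhds ?_
      rw [← nhdsNE_sup_pure, ← nhdsLT_sup_nhdsGT]
      exact eventually_sup.2 ⟨eventually_sup.2 ⟨hk, hr⟩, rfl⟩
  exact isPreconnected_Icc.constant hcont ht (Set.left_mem_Icc.2 (ht.1.trans ht.2))

/-- Every index is active throughout a dwell time, at arbitrarily late times. -/
theorem exists_window (hσ : IsSwitchingFunction σ) {τ : ℝ} (hτ : 0 < τ) (hdw : HasDwellTime σ τ)
    (hrec : IsRecurrent σ) (k : I) {T : ℝ} (hT : 0 ≤ T) :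
    ∃ a, T ≤ a ∧ ∀ t ∈ Set.Ioo a (a + τ), σ t = k ∧ t ∉ switchingTimes σ := by
  by_cases hk : ∀ l, l = k
  · refine ⟨T, le_rfl, fun t _ => ⟨hk _, ?_⟩⟩
    rintro ⟨-, l, m, hlm, -⟩
    exact hlm ((hk l).trans (hk m).symm)
  push Not at hk
  obtain ⟨l, hl⟩ := hk
  obtain ⟨s₀, hs₀, hσ₀⟩ := hrec l T hT
  obtain ⟨s, hs, hσs⟩ := hrec k s₀ (hT.trans hs₀)
  have hne : (switchingTimes σ ∩ Set.Ioc s₀ s).Nonempty := by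
    by_contra! hempty
    have := hσ.eq_of_forall_notMem (hT.trans hs₀)
      (fun t ht hts => Set.notMem_empty t (hempty ▸ ⟨hts, ht⟩)) (Set.right_mem_Icc.2 hs)
    exact hl (hσ₀ ▸ this ▸ hσs)
  have hbdd : BddAbove (switchingTimes σ ∩ Set.Ioc s₀ s) := ⟨s, fun r hr => hr.2.2⟩
  -- A switching time within τ of the supremum is the last one up to s, since the next comes at
  -- least τ later. So σ a = σ s = k and the mode lasts until a + τ.
  obtain ⟨a, ⟨haσ, has⟩, ha⟩ := exists_lt_of_lt_csSup hne (sub_lt_self _ hτ)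
  have ha0 : 0 ≤ a := hT.trans (hs₀.trans has.1.le)
  have hak : σ s = σ a := hσ.eq_of_forall_notMem ha0 (fun r hr hrσ => by
    have h1 := hdw a haσ r hrσ hr.1
    have h2 := le_csSup hbdd ⟨hrσ, has.1.trans hr.1, hr.2⟩
    linarith) (Set.right_mem_Icc.2 has.2)
  have hno : ∀ r, a < r → r < a + τ → r ∉ switchingTimes σ := fun r h1 h2 hr => by
    linarith [hdw a haσ r hr h1]
  refine ⟨a, hs₀.trans has.1.le, fun t ht => ⟨?_, hno t ht.1 ht.2⟩⟩
  rw [← hσs, hak]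
  exact hσ.eq_of_forall_notMem ha0 (fun r hr => hno r hr.1 (hr.2.trans_lt ht.2))
    (Set.right_mem_Icc.2 ht.1.le)

theorem spread_antitoneOn {n : ℕ} (hn : 2 ≤ n) {E : I → SimpleGraph (Fin n)}
    (hE : ∀ k, (E k).Connected) {ξ τ : ℝ} (hτ : 0 < τ) (hdw : HasDwellTime σ τ)
    {d : ℝ → Fin n → Fin n → ℝ} (hd : IsDisturbance ξ d) {x : ℝ → Fin n → ℝ}
    (hx : IsTrajectoryOn (Set.Ici 0) E σ ξ d x) :
    AntitoneOn (fun t => spread (x t)) (Set.Ici 0) := by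
  have : NeZero n := ⟨by omega⟩
  have hfree : ∀ a b, 0 ≤ a → a ≤ b → (∀ t ∈ Set.Ioo a b, t ∉ switchingTimes σ) →
      spread (x b) ≤ spread (x a) := fun a b ha hab hno => by
    refine spread_le_spread_of_hasDerivAt hab
      (hx.1.mono (Set.Icc_subset_Ici_self.trans (Set.Ici_subset_Ici.2 ha))) fun t ht => ?_
    have ht0 : 0 < t := ha.trans_lt ht.1
    obtain ⟨v, hv, hder⟩ := hx.2 t (by rwa [interior_Ici]) (hno t ht)
    exact ⟨v, hder, fun i =>
      hv.le_sum_max (hd.2 t ht0.le) (card_nbrs_pos _ hn (hE _) i)⟩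
  -- Such an interval contains at most one switch, and a switch at an endpoint is harmless because
  -- the maximum principle needs only continuity there.
  have hshort : ∀ a b, 0 ≤ a → a ≤ b → b - a < τ → spread (x b) ≤ spread (x a) := by
    intro a b ha hab hlt
    by_cases hc : ∃ c ∈ Set.Ioo a b, c ∈ switchingTimes σ
    · obtain ⟨c, hc, hcσ⟩ := hc
      refine (hfree c b (ha.trans hc.1.le) hc.2.le fun t ht htσ => ?_).trans
        (hfree a c ha hc.1.le fun t ht htσ => ?_)
      · linarith [hdw c hcσ t htσ ht.1, hc.1, ht.2]
      · linarith [hdw t htσ c hcσ ht.2, hc.2, ht.1]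
    · push Not at hc
      exact hfree a b ha hab hc
  have hsteps : ∀ m : ℕ, ∀ a b, 0 ≤ a → a ≤ b → b - a ≤ m * (τ / 2) →
      spread (x b) ≤ spread (x a) := by
    intro m
    induction m with
    | zero =>
      intro a b _ hab h
      rw [le_antisymm hab (by simpa using h)]
    | succ m ih =>
      intro a b ha hab h
      push_cast at h
      rcases le_or_gt (b - a) (τ / 2) with h1 | h1
      · exact hshort a b ha hab (by linarith)
      · exact (hshort (b - τ / 2) b (by linarith) (by linarith) (by linarith)).trans
          (ih a (b - τ / 2) ha (by linarith) (by linarith))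
  intro a ha b _ hab
  obtain ⟨m, hm⟩ := exists_nat_ge ((b - a) / (τ / 2))
  exact hsteps m a b ha hab ((div_le_iff₀ (by linarith)).1 hm)

theorem exists_spread_le {n : ℕ} (hn : 2 ≤ n) {E : I → SimpleGraph (Fin n)}
    (hE : ∀ k, (E k).Connected) {ξ ν γ τ q : ℝ} (hξ : 0 < ξ) (hν : 0 < ν) (hγ0 : 0 < γ)
    (hγ1 : γ < 1) {k : I} (hq : IsSettlingTime (E k) ξ ν γ q) (hqτ : q ≤ τ)
    (hσ : IsSwitchingFunction σ) (hdw : HasDwellTime σ τ) (hrec : IsRecurrent σ)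
    {d : ℝ → Fin n → Fin n → ℝ} (hd : IsDisturbance ξ d) {x : ℝ → Fin n → ℝ}
    (hx : IsTrajectoryOn (Set.Ici 0) E σ ξ d x) :
    ∃ T, 0 ≤ T ∧ spread (x T) ≤ maxSpread ξ (disturbanceBox n ξ) (E k) + 2 * ν := by
  have : NeZero n := ⟨by omega⟩
  have hτ : 0 < τ := hq.1.trans_le hqτ
  have hanti := spread_antitoneOn hn hE hτ hdw hd hx
  have hL := maxSpread_nonneg hn (hE k) hξ
  set B := maxSpread ξ (disturbanceBox n ξ) (E k) + 2 * ν with hB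
  -- One window of mode k per step: either a factor γ is gained, or the state is within ν of P(D,
  -- E_k) and its spread is at most B.
  have key : ∀ m : ℕ, ∃ T, 0 ≤ T ∧ spread (x T) ≤ max (γ ^ m * spread (x 0)) B := by
    intro m
    induction m with
    | zero => exact ⟨0, le_rfl, by simp⟩
    | succ m ih =>
      obtain ⟨T, hT, hle⟩ := ih
      obtain ⟨a, hTa, ha⟩ := exists_window hσ hτ hdw hrec k hT
      have ha0 : 0 ≤ a := hT.trans hTa
      have hfix : IsFixedTrajectoryOn (Set.Icc a (a + q)) (E k) ξ d x := by
        refine ⟨hx.1.mono (Set.Icc_subset_Ici_self.trans (Set.Ici_subset_Ici.2 ha0)),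
          fun t ht _ => ?_⟩
        rw [interior_Icc] at ht
        obtain ⟨h1, h2⟩ := ha t ⟨ht.1, by linarith [ht.2]⟩
        obtain ⟨v, hv, hder⟩ := hx.2 t (by rw [interior_Ici]; exact ha0.trans_lt ht.1) h2
        exact ⟨v, h1 ▸ hv, hder⟩
      obtain ⟨s, hs, hcase⟩ := hq.2 d hd a ha0 x hfix
      refine ⟨s, ha0.trans hs.1, ?_⟩
      rcases hcase with h | ⟨y, hy, hxy⟩
      · have h1 : spread (x a) ≤ spread (x T) := hanti hT ha0 hTa
        have h2 : spread (x s) ≤ γ * max (γ ^ m * spread (x 0)) B :=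
          h.le.trans (mul_le_mul_of_nonneg_left (h1.trans hle) hγ0.le)
        rw [mul_max_of_nonneg _ _ hγ0.le] at h2
        refine h2.trans (max_le_max (le_of_eq (by ring)) ?_)
        exact mul_le_of_le_one_left (by linarith) hγ1.le
      · refine le_max_of_le_right ((spread_le_add (x s) y).trans ?_)
        have h1 := (isGreatest_maxSpread hn (hE k) hξ).2 ⟨y, hy, rfl⟩
        linarith
  have hlim : Tendsto (fun m : ℕ => γ ^ m * spread (x 0)) atTop (𝓝 0) := by
    simpa using (tendsto_pow_atTop_nhds_zero_of_lt_one hγ0.le hγ1).mul_const (spread (x 0))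
  obtain ⟨m, hm⟩ := (hlim.eventually (gt_mem_nhds (by linarith : (0 : ℝ) < B))).exists
  obtain ⟨T, hT, hle⟩ := key m
  exact ⟨T, hT, hle.trans (max_le hm.le le_rfl)⟩

end Switching

theorem theorem4 {n : ℕ} (hn : 2 ≤ n) {I : Type*} [Finite I]
    (E : I → SimpleGraph (Fin n)) (hE : ∀ k, (E k).Connected)
    (ξ ν γ : ℝ) (hξ : 0 < ξ) (hν : 0 < ν) (hγ0 : 0 < γ) (hγ1 : γ < 1) :
    -- the maxima `L(D, E_k)` and the times `q_k(ν, γ)` exist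
    (∀ k, IsGreatest (spread '' setP ξ (disturbanceBox n ξ) (E k))
      (maxSpread ξ (disturbanceBox n ξ) (E k))) ∧
    (∀ k, ∃ q, IsSettlingTime (E k) ξ ν γ q) ∧
    -- with the dwell time `max_k q_k(ν, γ)`, the state is driven in finite time to the tube
    ∀ q : I → ℝ, (∀ k, IsSettlingTime (E k) ξ ν γ (q k)) →
      ∀ σ : ℝ → I, IsSwitchingFunction σ → HasDwellTime σ (⨆ k, q k) → IsRecurrent σ →
      ∀ d : ℝ → Fin n → Fin n → ℝ, IsDisturbance ξ d →
      ∀ x : ℝ → Fin n → ℝ, IsTrajectoryOn (Set.Ici 0) E σ ξ d x →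
        ∃ T : ℝ, 0 < T ∧ ∀ t, T ≤ t →
          x t ∈ ⋂ k, tubeS ξ (disturbanceBox n ξ) (E k) ν := by
  refine ⟨fun k => isGreatest_maxSpread hn (hE k) hξ,
    fun k => exists_isSettlingTime hn (hE k) hξ hν hγ0, ?_⟩
  intro q hq σ hσ hdw hrec d hd x hx
  have hqτ : ∀ k, q k ≤ ⨆ k, q k := le_ciSup (Set.finite_range q).bddAbove
  have hτ : 0 < ⨆ k, q k := (hq (σ 0)).1.trans_le (hqτ _)
  choose T hT0 hT using fun k =>
    exists_spread_le hn hE hξ hν hγ0 hγ1 (hq k) (hqτ k) hσ hdw hrec hd hx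
  obtain ⟨M, hM⟩ := (Set.finite_range T).bddAbove
  -- M bounds the finitely many entry times; the 1 makes the final time positive.
  refine ⟨max M 1, by positivity, fun t ht => Set.mem_iInter.2 fun k => ?_⟩
  have htk : T k ≤ t := (hM ⟨k, rfl⟩).trans ((le_max_left _ _).trans ht)
  exact (spread_antitoneOn hn hE hτ hdw hd hx (hT0 k) ((hT0 k).trans htk) htk).trans (hT k)
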